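/- For integers $n,k\ge 1$ put $\zeta_n(k)=\sum_{j=1}^n \frac1{j^k}$ and $L_n(k)=\sum_{j=1}^n\frac{(-1)^{j-1}}{j^k}$. A linear Euler sum of weight $v$ is one of the numbers $$\sum_{n=1}^\infty \frac{\zeta_n(a)}{n^b},\quad \sum_{n=1}^\infty \frac{L_n(a)}{n^b},\quad \sum_{n=1}^\infty \frac{\zeta_n(a)}{n^b}(-1)^{n-1},\quad \sum_{n=1}^\infty \frac{L_n(a)}{n^b}(-1)^{n-1},$$ with integers $a\ge1$, $b\ge2$ and $a+b=v$. A zeta monomial of weight $u$ is a finite (possibly empty) product of factors from among $\ln 2$ (of weight $1$), the zeta values $\zeta(k)=\sum_{n\ge1} n^{-k}$ with $k\ge2$, and the alternating zeta values $\bar\zeta(k)=\sum_{n\ge1}(-1)^{n-1}n^{-k}$ with $k\ge1$ (each of weight $k$), whose weights add up to $u$. Theorem. Let $p\ge2$ and $m\ge0$ be integers and let $w=2p+2m+2$. Then the series $$\sum_{n=1}^\infty \frac{\zeta_n(p)\,\zeta_n(p+2m+1)}{n}(-1)^{n-1}\qquad\text{and}\qquad \sum_{n=1}^\infty \frac{L_n(p)\,L_n(p+2m+1)}{n}(-1)^{n-1}$$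 converge, and each is reducible to linear Euler sums and to polynomials in $\ln 2$ and the (alternating) zeta values, homogeneously in the weight: its value is a finite linear combination, with rational coefficients, of zeta monomials of weight $w$ and of products of a zeta monomial of weight $u$ with a linear Euler sum of weight $v$, where $u+v=w$. -/

import Mathlib

open Filter Topology

namespace EulerSums

noncomputable section

/-- The convergent series `∑_{n ≥ 1} f n` has the value `S`: its partial sums
`f 1 + ⋯ + f N` tend to `S`. (Several of the series below converge only conditionally.) -/
def SeriesEq (f : ℕ → ℝ) (S : ℝ) : Prop :=
  Tendsto (fun N : ℕ => ∑ n ∈ Finset.Icc 1 N, f n) atTop (𝓝 S)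

/-- The sign `(-1)^(n-1)`, for `n ≥ 1`. -/
def altSign (n : ℕ) : ℝ := (-1) ^ (n - 1)

/-- The generalized harmonic number `ζ_n(k) = ∑_{j=1}^n 1 / j^k`. -/
def harm (k n : ℕ) : ℝ := ∑ j ∈ Finset.Icc 1 n, 1 / (j : ℝ) ^ k

/-- The alternating harmonic number `L_n(k) = ∑_{j=1}^n (-1)^(j-1) / j^k`. -/
def altHarm (k n : ℕ) : ℝ := ∑ j ∈ Finset.Icc 1 n, altSign j / (j : ℝ) ^ k

/-- `IsZetaMonomial w x`: the real number `x` is a product of finitely many factors taken from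
`ln 2` (weight `1`), the zeta values `ζ(k)`, `k ≥ 2`, and the alternating zeta values
`ζ̄(k) = ∑ (-1)^(n-1) / n^k`, `k ≥ 1` (both of weight `k`), and `w` is the total weight. -/
inductive IsZetaMonomial : ℕ → ℝ → Prop
  | one : IsZetaMonomial 0 1
  | log_two_mul {w : ℕ} {x : ℝ} (hx : IsZetaMonomial w x) :
      IsZetaMonomial (w + 1) (Real.log 2 * x)
  | zeta_mul {w k : ℕ} {x z : ℝ} (hk : 2 ≤ k) (hz : SeriesEq (fun n => 1 / (n : ℝ) ^ k) z)
      (hx : IsZetaMonomial w x) : IsZetaMonomial (w + k) (z * x)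
  | altZeta_mul {w k : ℕ} {x z : ℝ} (hk : 1 ≤ k)
      (hz : SeriesEq (fun n => altSign n / (n : ℝ) ^ k) z)
      (hx : IsZetaMonomial w x) : IsZetaMonomial (w + k) (z * x)

/-- `IsLinearSum w S`: the real number `S` is one of the four kinds of linear Euler sums,
`∑ ζ_n(a) / n^b`, `∑ L_n(a) / n^b`, `∑ (-1)^(n-1) ζ_n(a) / n^b`, `∑ (-1)^(n-1) L_n(a) / n^b`,
with `a ≥ 1`, `b ≥ 2` and weight `a + b = w`. -/
def IsLinearSum (w : ℕ) (S : ℝ) : Prop :=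
  ∃ a b : ℕ, 1 ≤ a ∧ 2 ≤ b ∧ a + b = w ∧
    (SeriesEq (fun n => harm a n / (n : ℝ) ^ b) S ∨
      SeriesEq (fun n => altHarm a n / (n : ℝ) ^ b) S ∨
      SeriesEq (fun n => harm a n / (n : ℝ) ^ b * altSign n) S ∨
      SeriesEq (fun n => altHarm a n / (n : ℝ) ^ b * altSign n) S)

/-- The real numbers that are reducible, in weight `w`, to linear Euler sums and to polynomials
in `ln 2` and the (alternating) zeta values: the rational linear combinations of zeta monomials of
weight `w` and of products (zeta monomial of weight `u`) · (linear Euler sum of weight `v`) with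
`u + v = w`. -/
def reducibleToLinear (w : ℕ) : Submodule ℚ ℝ :=
  Submodule.span ℚ
    ({x : ℝ | IsZetaMonomial w x} ∪
      {x : ℝ | ∃ (u v : ℕ) (c S : ℝ),
        IsZetaMonomial u c ∧ IsLinearSum v S ∧ u + v = w ∧ x = c * S})

end

end EulerSums

namespace EulerSums

noncomputable section

/-! ### Zeta monomials and the reducible numbers -/

/-! Put q = p + 2m + 1 and write H_n for `signHarm ε`. Up to sign, both series are ∑ (-1)^n/n ·
H_n(p) H_n(q), with ε = 1 and ε = -1. At n ≥ 0 the function `shiftSum ε p` on ℤ equals H_n(p) up to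
the sign ε^n and a zeta constant; at -n it is a tail of the zeta series. Sum (-1)^n/n · `shiftSum ε
p n` · `shiftSum ε q n` over the nonzero integers. Since p + q is odd, the products H_n(p) H_n(q)
coming from n and -n reinforce each other, and all other terms give linear sums or zeta values
(`redSeries_of_altGood_mul`).

The same sum can be evaluated directly. Expand the product into a double sum over k and l. The
diagonal is linear. Off the diagonal, partial fractions trade powers of 1/((n - k)(n - l)) for
powers of 1/(l - k) (`offDiagSum_succ_succ`). The recursion ends at two simple poles, where parity
makes the sum antisymmetric in k and l, hence zero (`offDiagSum_one_one`), or when one pole has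
disappeared. In the latter case the sum over l is explicit (`offDiagSum_zero`), and exchanging the
sums over k and n (`altGood_tailShiftSum`) leaves the kernel ∑_n (-1)^n/(n (n - k)^p). By
`altKernel_one` and `altKernel_succ` this is a combination of powers of 1/k, the sign (-1)^k and
zeta values, so only linear sums in k remain. -/

theorem IsZetaMonomial.mul {u w : ℕ} {c x : ℝ} (hc : IsZetaMonomial u c)
    (hx : IsZetaMonomial w x) : IsZetaMonomial (u + w) (c * x) := by
  induction hc with
  | one => simpa using hx
  | log_two_mul _ ih =>
    rw [mul_assoc, add_right_comm]
    exact .log_two_mul ih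
  | zeta_mul hk hz _ ih =>
    rw [mul_assoc, add_right_comm]
    exact .zeta_mul hk hz ih
  | altZeta_mul hk hz _ ih =>
    rw [mul_assoc, add_right_comm]
    exact .altZeta_mul hk hz ih

theorem IsZetaMonomial.mul_mem {u w : ℕ} {c y : ℝ} (hc : IsZetaMonomial u c)
    (hy : y ∈ reducibleToLinear w) : c * y ∈ reducibleToLinear (w + u) := by
  unfold reducibleToLinear at hy
  induction hy using Submodule.span_induction with
  | mem x hx =>
    apply Submodule.subset_span
    rcases hx with hx | ⟨u', v, c', S, hc', hS, huv, rfl⟩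
    · exact Or.inl (add_comm u w ▸ hc.mul hx)
    · exact Or.inr ⟨u + u', v, c * c', S, hc.mul hc', hS, by omega, by ring⟩
  | zero => simp
  | add x y _ _ hx hy => rw [mul_add]; exact add_mem hx hy
  | smul a x _ hx => rw [mul_smul_comm]; exact Submodule.smul_mem _ _ hx

theorem one_mem_reducibleToLinear : (1 : ℝ) ∈ reducibleToLinear 0 :=
  Submodule.subset_span (Or.inl .one)

theorem IsLinearSum.mem {w : ℕ} {S : ℝ} (hS : IsLinearSum w S) : S ∈ reducibleToLinear w :=
  Submodule.subset_span (Or.inr ⟨0, w, 1, S, .one, hS, by simp, by simp⟩)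

theorem ratCast_mul_mem {w : ℕ} {x : ℝ} (q : ℚ) (hx : x ∈ reducibleToLinear w) :
    (q : ℝ) * x ∈ reducibleToLinear w := by
  rw [← Rat.smul_def]; exact Submodule.smul_mem _ _ hx

/-! ### Series with reducible value -/

/-- The series `∑_{n ≥ 1} f n` converges to a number that is reducible in weight `w`. -/
def RedSeries (w : ℕ) (f : ℕ → ℝ) : Prop :=
  ∃ S : ℝ, SeriesEq f S ∧ S ∈ reducibleToLinear w

theorem SeriesEq.congr {f g : ℕ → ℝ} {S : ℝ} (hf : SeriesEq f S)
    (h : ∀ n, 1 ≤ n → f n = g n) : SeriesEq g S := by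
  refine Tendsto.congr (fun N => ?_) hf
  exact Finset.sum_congr rfl fun n hn => h n (Finset.mem_Icc.1 hn).1

theorem SeriesEq.add {f g : ℕ → ℝ} {S T : ℝ} (hf : SeriesEq f S) (hg : SeriesEq g T) :
    SeriesEq (fun n => f n + g n) (S + T) := by
  unfold SeriesEq
  simp only [Finset.sum_add_distrib]
  exact Tendsto.add hf hg

theorem SeriesEq.const_mul {f : ℕ → ℝ} {S : ℝ} (c : ℝ) (hf : SeriesEq f S) :
    SeriesEq (fun n => c * f n) (c * S) := by
  unfold SeriesEq
  simp only [← Finset.mul_sum]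
  exact Tendsto.const_mul c hf

theorem sum_Icc_one_eq_sub (f : ℕ → ℝ) (N : ℕ) :
    ∑ n ∈ Finset.Icc 1 N, f n = ∑ n ∈ Finset.range (N + 1), f n - f 0 := by
  rw [Finset.sum_range_succ', add_sub_cancel_right, Finset.range_eq_Ico,
    Finset.sum_Ico_add' f 0 N 1]
  rfl

theorem seriesEq_iff {f : ℕ → ℝ} {S : ℝ} :
    SeriesEq f S ↔ Tendsto (fun N => ∑ n ∈ Finset.range N, f n) atTop (𝓝 (S + f 0)) := by
  unfold SeriesEq
  simp only [sum_Icc_one_eq_sub]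
  rw [← tendsto_add_atTop_iff_nat (f := fun N => ∑ n ∈ Finset.range N, f n) 1]
  constructor
  · intro h; simpa using h.add_const (f 0)
  · intro h; simpa using h.sub_const (f 0)

theorem _root_.HasSum.seriesEq {f : ℕ → ℝ} {S : ℝ} (hf : HasSum f S) :
    SeriesEq f (S - f 0) := by
  rw [seriesEq_iff]; simpa using hf.tendsto_sum_nat

namespace RedSeries

variable {w : ℕ} {f g : ℕ → ℝ}

theorem congr (hf : RedSeries w f) (h : ∀ n, 1 ≤ n → f n = g n) : RedSeries w g :=
  let ⟨S, hS, hm⟩ := hf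
  ⟨S, hS.congr h, hm⟩

theorem add (hf : RedSeries w f) (hg : RedSeries w g) : RedSeries w (fun n => f n + g n) :=
  let ⟨_, hS, hm⟩ := hf
  let ⟨_, hT, hm'⟩ := hg
  ⟨_, hS.add hT, add_mem hm hm'⟩

theorem ratCast_mul (q : ℚ) (hf : RedSeries w f) : RedSeries w (fun n => (q : ℝ) * f n) :=
  let ⟨_, hS, hm⟩ := hf
  ⟨_, hS.const_mul _, ratCast_mul_mem q hm⟩

theorem neg (hf : RedSeries w f) : RedSeries w (fun n => - f n) :=
  (hf.ratCast_mul (-1)).congr fun n _ => by simp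

theorem sub (hf : RedSeries w f) (hg : RedSeries w g) : RedSeries w (fun n => f n - g n) :=
  (hf.add hg.neg).congr fun n _ => by ring

theorem zero : RedSeries w (fun _ => 0) :=
  ⟨0, by simp [SeriesEq], zero_mem _⟩

end RedSeries

/-! ### Signed harmonic numbers and zeta values -/

/-- `ε` is one of the two signs `1` and `-1`. -/
def IsSign (ε : ℝ) : Prop := ε = 1 ∨ ε = -1

theorem isSign_one : IsSign 1 := Or.inl rfl

theorem isSign_neg_one : IsSign (-1) := Or.inr rfl

theorem IsSign.mul {ε δ : ℝ} (hε : IsSign ε) (hδ : IsSign δ) : IsSign (ε * δ) := by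
  rcases hε with rfl | rfl <;> rcases hδ with rfl | rfl <;> simp [IsSign]

theorem IsSign.mul_self_pow {ε : ℝ} (hε : IsSign ε) (n : ℕ) : ε ^ n * ε ^ n = 1 := by
  rcases hε with rfl | rfl
  · simp
  · rw [← mul_pow]; simp

theorem IsSign.abs_pow {ε : ℝ} (hε : IsSign ε) (n : ℕ) : |ε ^ n| = 1 := by
  rcases hε with rfl | rfl <;> simp

/-- `∑_{j=1}^n ε^j / j^a` (for `a ≥ 1`). -/
def signHarm (ε : ℝ) (a n : ℕ) : ℝ := ∑ j ∈ Finset.range (n + 1), ε ^ j * ((j : ℝ)⁻¹) ^ a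

/-- `∑_{j≥1} ε^j / j^a` (for `a ≥ 2`). -/
def signZeta (ε : ℝ) (a : ℕ) : ℝ := ∑' j : ℕ, ε ^ j * ((j : ℝ)⁻¹) ^ a

theorem altSign_eq {n : ℕ} (hn : 1 ≤ n) : altSign n = -(-1) ^ n := by
  obtain ⟨k, rfl⟩ := Nat.exists_eq_add_of_le' hn
  simp [altSign, pow_succ]

theorem signHarm_eq_sum_Icc (ε : ℝ) {a : ℕ} (ha : 1 ≤ a) (n : ℕ) :
    signHarm ε a n = ∑ j ∈ Finset.Icc 1 n, ε ^ j * ((j : ℝ)⁻¹) ^ a := by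
  rw [sum_Icc_one_eq_sub, signHarm]
  simp [show a ≠ 0 by omega]

theorem harm_eq {a : ℕ} (ha : 1 ≤ a) (n : ℕ) : harm a n = signHarm 1 a n := by
  rw [signHarm_eq_sum_Icc _ ha, harm]
  simp

theorem altHarm_eq {a : ℕ} (ha : 1 ≤ a) (n : ℕ) : altHarm a n = -signHarm (-1) a n := by
  rw [signHarm_eq_sum_Icc _ ha, altHarm, ← Finset.sum_neg_distrib]
  refine Finset.sum_congr rfl fun j hj => ?_
  rw [altSign_eq (Finset.mem_Icc.1 hj).1]
  simp [div_eq_mul_inv]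

theorem summable_inv_pow {a : ℕ} (ha : 2 ≤ a) : Summable fun j : ℕ => ((j : ℝ)⁻¹) ^ a := by
  simpa using (Real.summable_nat_pow_inv (p := a)).2 (by omega)

theorem summable_sign_mul {ι : Type*} {ε : ℝ} (hε : IsSign ε) (s : ι → ℕ) {f : ι → ℝ}
    (hf : Summable fun i => |f i|) : Summable fun i => ε ^ s i * f i := by
  refine Summable.of_abs ?_
  simpa [abs_mul, hε.abs_pow] using hf

theorem summable_sign_inv_pow {ε : ℝ} (hε : IsSign ε) {a : ℕ} (ha : 2 ≤ a) :
    Summable fun j : ℕ => ε ^ j * ((j : ℝ)⁻¹) ^ a :=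
  summable_sign_mul hε _ (summable_inv_pow ha).abs

theorem tendsto_signHarm {ε : ℝ} (hε : IsSign ε) {a : ℕ} (ha : 2 ≤ a) :
    Tendsto (signHarm ε a) atTop (𝓝 (signZeta ε a)) :=
  (tendsto_add_atTop_iff_nat 1).2 (summable_sign_inv_pow hε ha).hasSum.tendsto_sum_nat

theorem tendsto_signHarm_neg_one_one : ∃ S, Tendsto (signHarm (-1) 1) atTop (𝓝 S) := by
  have hanti : Antitone fun n : ℕ => ((n : ℝ) + 1)⁻¹ := fun m n h => by
    show ((n : ℝ) + 1)⁻¹ ≤ ((m : ℝ) + 1)⁻¹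
    gcongr
  have h0 : Tendsto (fun n : ℕ => ((n : ℝ) + 1)⁻¹) atTop (𝓝 0) := by
    simpa using tendsto_one_div_add_atTop_nhds_zero_nat (𝕜 := ℝ)
  obtain ⟨l, hl⟩ := hanti.tendsto_alternating_series_of_tendsto_zero h0
  refine ⟨-l, hl.neg.congr fun n => ?_⟩
  rw [signHarm, Finset.sum_range_succ', ← Finset.sum_neg_distrib]
  simp [pow_succ]

theorem exists_tendsto_signHarm {ε : ℝ} (hε : IsSign ε) {a : ℕ} (ha : 1 ≤ a)
    (h : 2 ≤ a ∨ ε = -1) : ∃ S, Tendsto (signHarm ε a) atTop (𝓝 S) := by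
  by_cases h2 : 2 ≤ a
  · exact ⟨_, tendsto_signHarm hε h2⟩
  · obtain rfl : a = 1 := by omega
    obtain rfl : ε = -1 := by simpa using h
    exact tendsto_signHarm_neg_one_one

theorem seriesEq_sign_iff (ε : ℝ) {a : ℕ} (ha : 1 ≤ a) (S : ℝ) :
    SeriesEq (fun n => ε ^ n * ((n : ℝ)⁻¹) ^ a) S ↔ Tendsto (signHarm ε a) atTop (𝓝 S) := by
  unfold SeriesEq
  exact tendsto_congr fun N => (signHarm_eq_sum_Icc ε ha N).symm

/-- The value of `∑ ε^n / n^a` is, up to sign, a zeta monomial. -/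
theorem exists_isZetaMonomial {ε : ℝ} (hε : IsSign ε) {a : ℕ} (ha : 1 ≤ a)
    (h : 2 ≤ a ∨ ε = -1) {S : ℝ} (hS : Tendsto (signHarm ε a) atTop (𝓝 S)) :
    IsZetaMonomial a S ∨ IsZetaMonomial a (-S) := by
  rw [← seriesEq_sign_iff _ ha] at hS
  rcases hε with rfl | rfl
  · left
    have h2 : 2 ≤ a := by
      rcases h with h | h
      · exact h
      · norm_num at h
    simpa using IsZetaMonomial.zeta_mul h2 (hS.congr fun n _ => by simp) .one
  · right
    have := hS.const_mul (-1)
    simpa using IsZetaMonomial.altZeta_mul (z := -S) ha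
      (by simpa using this.congr fun n hn => by rw [altSign_eq hn]; simp [div_eq_mul_inv]) .one

theorem mul_mem_of_tendsto_signHarm {ε : ℝ} (hε : IsSign ε) {a w : ℕ} (ha : 1 ≤ a)
    (h : 2 ≤ a ∨ ε = -1) {S y : ℝ} (hS : Tendsto (signHarm ε a) atTop (𝓝 S))
    (hy : y ∈ reducibleToLinear w) : S * y ∈ reducibleToLinear (w + a) := by
  rcases exists_isZetaMonomial hε ha h hS with h | h
  · exact h.mul_mem hy
  · simpa using neg_mem (h.mul_mem hy)

theorem mem_of_tendsto_signHarm {ε : ℝ} (hε : IsSign ε) {a : ℕ} (ha : 1 ≤ a)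
    (h : 2 ≤ a ∨ ε = -1) {S : ℝ} (hS : Tendsto (signHarm ε a) atTop (𝓝 S)) :
    S ∈ reducibleToLinear a := by
  simpa using mul_mem_of_tendsto_signHarm hε ha h hS one_mem_reducibleToLinear

theorem signZeta_mem {ε : ℝ} (hε : IsSign ε) {a : ℕ} (ha : 2 ≤ a) :
    signZeta ε a ∈ reducibleToLinear a :=
  mem_of_tendsto_signHarm hε (by omega) (.inl ha) (tendsto_signHarm hε ha)

theorem RedSeries.signZeta_mul {ε : ℝ} (hε : IsSign ε) {a w : ℕ} (ha : 2 ≤ a) {f : ℕ → ℝ}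
    (hf : RedSeries w f) : RedSeries (w + a) (fun n => signZeta ε a * f n) :=
  let ⟨_, hS, hm⟩ := hf
  ⟨_, hS.const_mul _,
    mul_mem_of_tendsto_signHarm hε (by omega) (.inl ha) (tendsto_signHarm hε ha) hm⟩

theorem redSeries_sign_inv_pow {ε : ℝ} (hε : IsSign ε) {a : ℕ} (ha : 1 ≤ a)
    (h : 2 ≤ a ∨ ε = -1) : RedSeries a (fun n => ε ^ n * ((n : ℝ)⁻¹) ^ a) := by
  obtain ⟨S, hS⟩ := exists_tendsto_signHarm hε ha h
  exact ⟨S, (seriesEq_sign_iff _ ha _).2 hS, mem_of_tendsto_signHarm hε ha h hS⟩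

/-! ### Linear sums -/

/-- The only harmonic numbers excluded by `h` are the unbounded ones, a = 1 and ε = 1, so a bounded
factor multiplies a summable one. The four sign pairs are the four kinds of linear sums. -/
theorem redSeries_signHarm_of_two_le {ε δ : ℝ} (hε : IsSign ε) (hδ : IsSign δ) {a b : ℕ}
    (ha : 1 ≤ a) (h : 2 ≤ a ∨ ε = -1) (hb : 2 ≤ b) :
    RedSeries (a + b) (fun n => signHarm ε a n * (δ ^ n * ((n : ℝ)⁻¹) ^ b)) := by
  obtain ⟨L, hL⟩ := exists_tendsto_signHarm hε ha h
  obtain ⟨C, hC⟩ := (Metric.isBounded_range_of_tendsto _ hL).exists_norm_le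
  have hsum : Summable fun n : ℕ => signHarm ε a n * (δ ^ n * ((n : ℝ)⁻¹) ^ b) := by
    refine Summable.of_norm_bounded ((summable_inv_pow hb).mul_left C) fun n => ?_
    rw [norm_mul, norm_mul, Real.norm_eq_abs (δ ^ n), hδ.abs_pow, one_mul, norm_pow, norm_inv,
      Real.norm_natCast]
    gcongr
    exact hC _ ⟨n, rfl⟩
  obtain ⟨S, hS⟩ := Exists.intro _ hsum.hasSum.seriesEq
  refine ⟨S, hS, ?_⟩
  have hS' := hS.const_mul (-1)
  rcases hε with rfl | rfl <;> rcases hδ with rfl | rfl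
  · refine IsLinearSum.mem ⟨a, b, ha, hb, rfl, .inl (hS.congr fun n _ => ?_)⟩
    simp [harm_eq ha, div_eq_mul_inv]
  · rw [← neg_mem_iff]
    refine IsLinearSum.mem ⟨a, b, ha, hb, rfl, .inr (.inr (.inl ?_))⟩
    rw [← neg_one_mul]
    refine hS'.congr fun n hn => ?_
    rw [harm_eq ha, altSign_eq hn, inv_pow]; ring
  · rw [← neg_mem_iff]
    refine IsLinearSum.mem ⟨a, b, ha, hb, rfl, .inr (.inl ?_)⟩
    rw [← neg_one_mul]
    refine hS'.congr fun n hn => ?_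
    rw [altHarm_eq ha, inv_pow]; ring
  · refine IsLinearSum.mem ⟨a, b, ha, hb, rfl, .inr (.inr (.inr (hS.congr fun n hn => ?_)))⟩
    rw [altHarm_eq ha, altSign_eq hn, inv_pow]; ring

/-- Summation by parts. -/
theorem signHarm_mul_signHarm (ε δ : ℝ) {a b : ℕ} (ha : 1 ≤ a) (N : ℕ) :
    ∑ n ∈ Finset.Icc 1 N, (signHarm ε a n * (δ ^ n * ((n : ℝ)⁻¹) ^ b)
      + signHarm δ b n * (ε ^ n * ((n : ℝ)⁻¹) ^ a)
      - (ε * δ) ^ n * ((n : ℝ)⁻¹) ^ (a + b)) = signHarm ε a N * signHarm δ b N := by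
  induction N with
  | zero => simp [signHarm, show a ≠ 0 by omega]
  | succ N ih =>
    have h (ε : ℝ) (a : ℕ) : signHarm ε a (N + 1) =
        signHarm ε a N + ε ^ (N + 1) * (((N + 1 : ℕ) : ℝ)⁻¹) ^ a := Finset.sum_range_succ _ _
    rw [Finset.sum_Icc_succ_top (by omega), ih, h, h]
    ring

/-- Summation by parts swaps the exponents: the conditionally convergent case b = 1, not itself a
linear Euler sum, becomes one with denominator n^a, a ≥ 2. -/
theorem redSeries_signHarm {ε δ : ℝ} (hε : IsSign ε) (hδ : IsSign δ) {a b : ℕ}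
    (ha : 2 ≤ a) (hb : 1 ≤ b) (h : 2 ≤ b ∨ δ = -1) :
    RedSeries (a + b) (fun n => signHarm ε a n * (δ ^ n * ((n : ℝ)⁻¹) ^ b)) := by
  have hεδ := hε.mul hδ
  obtain ⟨L, hL⟩ := exists_tendsto_signHarm hδ hb h
  have h1 : RedSeries (a + b) _ :=
    ⟨_, (((tendsto_signHarm hε ha).mul hL).congr fun N =>
      (signHarm_mul_signHarm ε δ (by omega) N).symm), by
      have := mul_mem_of_tendsto_signHarm hε (by omega) (.inl ha) (tendsto_signHarm hε ha)
        (mem_of_tendsto_signHarm hδ hb h hL)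
      rwa [add_comm] at this⟩
  have h2 := redSeries_signHarm_of_two_le hδ hε hb h ha
  rw [add_comm] at h2
  have h3 := redSeries_sign_inv_pow (a := a + b) hεδ (by omega) (.inl (by omega))
  exact ((h1.sub h2).add h3).congr fun n _ => by ring

theorem redSeries_signZeta_sub {ε δ : ℝ} (hε : IsSign ε) (hδ : IsSign δ) {a b : ℕ}
    (ha : 2 ≤ a) (hb : 1 ≤ b) (h : 2 ≤ b ∨ δ = -1) :
    RedSeries (a + b)
      (fun n => (signZeta ε a - signHarm ε a n) * (δ ^ n * ((n : ℝ)⁻¹) ^ b)) := by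
  have h1 := (redSeries_sign_inv_pow hδ hb h).signZeta_mul hε ha
  rw [add_comm] at h1
  exact (h1.sub (redSeries_signHarm hε hδ ha hb h)).congr fun n _ => by ring

/-! ### One-sided sums of shifted powers -/

/-- `∑_{k ≥ 0, k ≠ n} ε^k / (n - k)^p` (for `p ≥ 2`). -/
def shiftSum (ε : ℝ) (p : ℕ) (n : ℤ) : ℝ := ∑' k : ℕ, ε ^ k * (((n : ℝ) - k)⁻¹) ^ p

theorem summable_int_inv_pow {p : ℕ} (hp : 2 ≤ p) : Summable fun n : ℤ => |((n : ℝ)⁻¹) ^ p| := by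
  have h := (Real.summable_one_div_int_pow (p := p)).2 (by omega)
  simpa using h.abs

theorem summable_shift {p : ℕ} (hp : 2 ≤ p) (n : ℤ) :
    Summable fun k : ℕ => |(((n : ℝ) - k)⁻¹) ^ p| := by
  have hinj : Function.Injective fun k : ℕ => n - (k : ℤ) := fun a b h => by
    simpa using h
  simpa [Function.comp_def] using (summable_int_inv_pow hp).comp_injective hinj

theorem hasSum_shiftSum {ε : ℝ} (hε : IsSign ε) {p : ℕ} (hp : 2 ≤ p) (n : ℤ) :
    HasSum (fun k : ℕ => ε ^ k * (((n : ℝ) - k)⁻¹) ^ p) (shiftSum ε p n) :=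
  (summable_sign_mul hε _ (summable_shift hp n)).hasSum

/-- Split after k = n: the terms k ≤ n, reversed, form the harmonic number (k = n contributes 0 as
0⁻¹ = 0), and the terms k > n form a full zeta series. -/
theorem shiftSum_natCast {ε : ℝ} (hε : IsSign ε) {p : ℕ} (hp : 2 ≤ p) (n : ℕ) :
    shiftSum ε p n = ε ^ n * (signHarm ε p n + (-1) ^ p * signZeta ε p) := by
  have h1 := (hasSum_shiftSum hε hp n).summable.sum_add_tsum_nat_add (n + 1)
  have h2 := (summable_sign_inv_pow hε hp).sum_add_tsum_nat_add 1
  rw [shiftSum, ← h1, signZeta, ← h2, mul_add, signHarm, Finset.mul_sum,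
    ← Finset.sum_range_reflect]
  simp only [Finset.range_one, Finset.sum_singleton, CharP.cast_eq_zero, inv_zero]
  rw [zero_pow (by omega), mul_zero, zero_add, ← tsum_mul_left, ← tsum_mul_left]
  congr 1
  · refine Finset.sum_congr rfl fun j hj => ?_
    have hj : j ≤ n := by simpa [Nat.lt_succ_iff] using hj
    have h3 : ε ^ (n - j) = ε ^ n * ε ^ j := by
      obtain ⟨m, rfl⟩ := Nat.exists_eq_add_of_le hj
      rw [Nat.add_sub_cancel_left, pow_add, mul_right_comm, hε.mul_self_pow, one_mul]
    rw [show n + 1 - 1 - j = n - j by omega, Nat.cast_sub hj, h3]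
    simp [mul_assoc]
  · refine tsum_congr fun k => ?_
    rw [show ((n : ℤ) : ℝ) - ((k + (n + 1) : ℕ) : ℝ) = -((k + 1 : ℕ) : ℝ) by push_cast; ring,
      inv_neg, neg_pow (((k + 1 : ℕ) : ℝ)⁻¹)]
    ring

/-- With j = n + k this is a zeta tail starting at j = n, a term that the harmonic number has
removed and that is added back. -/
theorem shiftSum_neg {ε : ℝ} (hε : IsSign ε) {p : ℕ} (hp : 2 ≤ p) (n : ℕ) :
    shiftSum ε p (-n) =
      ε ^ n * (-1) ^ p * (signZeta ε p - signHarm ε p n + ε ^ n * ((n : ℝ)⁻¹) ^ p) := by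
  have h2 := (summable_sign_inv_pow hε hp).sum_add_tsum_nat_add n
  rw [shiftSum, signZeta, ← h2, signHarm, Finset.sum_range_succ]
  rw [show ∀ a b c : ℝ, a + b - (a + c) + c = b from fun a b c => by ring, ← tsum_mul_left]
  refine tsum_congr fun k => ?_
  rw [show ((-n : ℤ) : ℝ) - (k : ℝ) = -((k + n : ℕ) : ℝ) by push_cast; ring,
      inv_neg, neg_pow (((k + n : ℕ) : ℝ)⁻¹), pow_add]
  linear_combination (-1) ^ p * (((k + n : ℕ) : ℝ)⁻¹) ^ p * ε ^ k * (-hε.mul_self_pow n)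

/-! ### Alternating sums over the nonzero integers -/

/-- The alternating series of `f n / n` over the nonzero integers, taken symmetrically, is
reducible in weight `w`. -/
def AltGood (w : ℕ) (f : ℤ → ℝ) : Prop :=
  RedSeries w fun n => (-1) ^ n * (n : ℝ)⁻¹ * (f n - f (-n))

namespace AltGood

variable {w : ℕ} {f g : ℤ → ℝ}

theorem congr (hf : AltGood w f) (h : ∀ n : ℕ, 1 ≤ n → f n = g n ∧ f (-n) = g (-n)) :
    AltGood w g :=
  RedSeries.congr hf fun n hn => by rw [(h n hn).1, (h n hn).2]

theorem add (hf : AltGood w f) (hg : AltGood w g) : AltGood w (fun n => f n + g n) :=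
  (RedSeries.add hf hg).congr fun n _ => by ring

theorem ratCast_mul (q : ℚ) (hf : AltGood w f) : AltGood w (fun n => (q : ℝ) * f n) :=
  (RedSeries.ratCast_mul q hf).congr fun n _ => by ring

theorem sub (hf : AltGood w f) (hg : AltGood w g) : AltGood w (fun n => f n - g n) :=
  (RedSeries.sub hf hg).congr fun n _ => by ring

theorem zero : AltGood w (fun _ => 0) :=
  RedSeries.zero.congr fun n _ => by ring

theorem signZeta_mul {ε : ℝ} (hε : IsSign ε) {a : ℕ} (ha : 2 ≤ a) (hf : AltGood w f) :
    AltGood (w + a) (fun n => signZeta ε a * f n) :=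
  (RedSeries.signZeta_mul hε ha hf).congr fun n _ => by ring

end AltGood

/-- The zeta constants at n and -n cancel. -/
theorem altGood_shiftSum_one {p : ℕ} (hp : 2 ≤ p) : AltGood (p + 1) (shiftSum 1 p) := by
  have h1 := redSeries_signHarm isSign_one isSign_neg_one hp le_rfl (.inr rfl)
  have h2 := redSeries_sign_inv_pow isSign_neg_one (a := p + 1) (by omega) (.inl (by omega))
  refine ((h1.ratCast_mul (1 + (-1) ^ p)).sub (h2.ratCast_mul ((-1) ^ p))).congr fun n _ => ?_
  rw [shiftSum_natCast isSign_one hp, shiftSum_neg isSign_one hp]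
  push_cast
  ring

theorem altGood_ite {ε : ℝ} (hε : IsSign ε) {p : ℕ} (hp : 2 ≤ p) :
    AltGood (p + 1) (fun n => if 0 ≤ n then
      signHarm ε p n.toNat + (-1) ^ p * signZeta ε p else 0) := by
  have h1 := redSeries_signHarm hε isSign_neg_one hp le_rfl (.inr rfl)
  have h2 := (redSeries_sign_inv_pow isSign_neg_one le_rfl (.inr rfl)).signZeta_mul hε hp
  rw [add_comm] at h2
  refine (h1.add (h2.ratCast_mul ((-1) ^ p))).congr fun n hn => ?_
  simp only [Int.natCast_nonneg, if_true, Int.toNat_natCast]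
  rw [if_neg (by omega)]
  push_cast
  ring

/-- Here P, Q are harmonic numbers, X, Y zeta values, x, y powers of 1/n, a = (-1)^p, b = (-1)^q and
e = ε^n. The parity condition ab = -1 doubles PQ and cancels XY. -/
theorem shiftSum_product_identity (P Q X Y x y : ℝ) {a b e : ℝ} (hab : a * b = -1)
    (he : e * e = 1) :
    e * (P + a * X) * (e * (Q + b * Y))
      - e * a * (X - P + e * x) * (e * b * (Y - Q + e * y)) =
    2 * (P * Q) + (b - 1) * (P * Y) + (a - 1) * (X * Q)
      + e * (X * y + x * Y - P * y - x * Q) + x * y := by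
  linear_combination ((P + a * X) * (Q + b * Y) - a * b * ((X - P + e * x) * (Y - Q + e * y))
    + x * y) * he + (X * Y - (X - P + e * x) * (Y - Q + e * y)) * hab

/-- Products of two one-sided sums give the quadratic sum up to linear sums. -/
theorem redSeries_of_altGood_mul {ε : ℝ} (hε : IsSign ε) {p q : ℕ} (hp : 2 ≤ p) (hq : 2 ≤ q)
    (hpq : Odd (p + q)) (h : AltGood (p + q + 1) fun n => shiftSum ε p n * shiftSum ε q n) :
    RedSeries (p + q + 1) fun n =>
      (-1) ^ n * (n : ℝ)⁻¹ * (signHarm ε p n * signHarm ε q n) := by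
  have hδ := hε.mul isSign_neg_one
  have hlin {p q : ℕ} (hp : 2 ≤ p) (hq : 2 ≤ q) :
      RedSeries (p + q + 1) fun n => signHarm ε p n * ((ε * -1) ^ n * ((n : ℝ)⁻¹) ^ (q + 1)) :=
    redSeries_signHarm hε hδ hp (b := q + 1) (by omega) (.inl (by omega))
  have hone {p q : ℕ} (hp : 2 ≤ p) (hq : 2 ≤ q) :
      RedSeries (p + q + 1) fun n =>
        signZeta ε p * (signHarm ε q n * ((-1) ^ n * ((n : ℝ)⁻¹) ^ 1)) := by
    have := (redSeries_signHarm hε isSign_neg_one hq le_rfl (.inr rfl)).signZeta_mul hε hp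
    rwa [show q + 1 + p = p + q + 1 by ring] at this
  have hz {p q : ℕ} (hp : 2 ≤ p) (hq : 2 ≤ q) :
      RedSeries (p + q + 1) fun n =>
        signZeta ε p * ((ε * -1) ^ n * ((n : ℝ)⁻¹) ^ (q + 1)) := by
    have := (redSeries_sign_inv_pow hδ (a := q + 1) (by omega) (.inl (by omega))).signZeta_mul
      hε hp
    rwa [show q + 1 + p = p + q + 1 by ring] at this
  have h0 := redSeries_sign_inv_pow isSign_neg_one (a := p + q + 1) (by omega)
    (.inl (by omega))
  have hl' := hlin hq hp
  have ho' := hone hq hp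
  have hz' := hz hq hp
  rw [add_comm q p] at hl' ho' hz'
  have hR : RedSeries (p + q + 1) _ := h
  have H := ((((((hR.add (hlin hp hq)).add hl').sub h0).add
    ((hone hp hq).ratCast_mul (1 - (-1) ^ p))).add
    (ho'.ratCast_mul (1 - (-1) ^ q))).sub (hz hp hq)).sub hz'
  refine (H.ratCast_mul (1 / 2)).congr fun n _ => ?_
  beta_reduce
  rw [shiftSum_natCast hε hp, shiftSum_neg hε hp, shiftSum_natCast hε hq, shiftSum_neg hε hq]
  have h1 : (-1 : ℝ) ^ p * (-1) ^ q = -1 := by rw [← pow_add]; exact hpq.neg_one_pow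
  have h3 : (ε * -1) ^ n = ε ^ n * (-1) ^ n := mul_pow _ _ _
  have key := shiftSum_product_identity (signHarm ε p n) (signHarm ε q n) (signZeta ε p)
    (signZeta ε q) ((n : ℝ)⁻¹ ^ p) ((n : ℝ)⁻¹ ^ q) h1 (hε.mul_self_pow n)
  push_cast
  rw [h3]
  linear_combination (1 / 2) * (-1) ^ n * (n : ℝ)⁻¹ * key

/-! ### Absolute convergence -/

/-- Lower the exponents to a permutation of (2,2,0) or of (2,1,1); the latter is bounded through 2yz
≤ y² + z². -/
theorem pow_mul_pow_mul_pow_le {x y z : ℝ} (hx : 0 ≤ x) (hy : 0 ≤ y) (hz : 0 ≤ z) (hx1 : x ≤ 1)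
    (hy1 : y ≤ 1) (hz1 : z ≤ 1) {r p q : ℕ} (h1 : 2 ≤ r + p) (h2 : 2 ≤ p + q) (h3 : 2 ≤ q + r)
    (h4 : 4 ≤ r + p + q) :
    x ^ r * y ^ p * z ^ q ≤ x ^ 2 * y ^ 2 + y ^ 2 * z ^ 2 + z ^ 2 * x ^ 2 := by
  have key (r' p' q' : ℕ) (hr : r' ≤ r) (hp : p' ≤ p) (hq : q' ≤ q) :
      x ^ r * y ^ p * z ^ q ≤ x ^ r' * y ^ p' * z ^ q' := by
    have := pow_le_pow_of_le_one hx hx1 hr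
    have := pow_le_pow_of_le_one hy hy1 hp
    have := pow_le_pow_of_le_one hz hz1 hq
    gcongr
  have hxy : 0 ≤ x ^ 2 * y ^ 2 := by positivity
  have hyz : 0 ≤ y ^ 2 * z ^ 2 := by positivity
  have hzx : 0 ≤ z ^ 2 * x ^ 2 := by positivity
  rcases Nat.eq_zero_or_pos r with hr | hr
  · have := key 0 2 2 (by omega) (by omega) (by omega)
    linarith
  rcases Nat.eq_zero_or_pos p with hp | hp
  · have := key 2 0 2 (by omega) (by omega) (by omega)
    linarith
  rcases Nat.eq_zero_or_pos q with hq | hq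
  · have := key 2 2 0 (by omega) (by omega) (by omega)
    linarith
  rcases (by omega : 2 ≤ r ∨ 2 ≤ p ∨ 2 ≤ q) with h | h | h
  · have := key 2 1 1 h hp hq
    nlinarith [mul_nonneg (sq_nonneg x) (sq_nonneg (y - z))]
  · have := key 1 2 1 hr h hq
    nlinarith [mul_nonneg (sq_nonneg y) (sq_nonneg (x - z))]
  · have := key 1 1 2 hr hp h
    nlinarith [mul_nonneg (sq_nonneg z) (sq_nonneg (x - y))]

theorem abs_int_inv_le_one (n : ℤ) : |((n : ℝ))⁻¹| ≤ 1 := by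
  rcases eq_or_ne n 0 with rfl | h
  · simp
  · rw [abs_inv]
    exact inv_le_one_of_one_le₀ (by exact_mod_cast Int.one_le_abs h)

theorem summable_inv_sq_mul_inv_sq {ι : Type*} {u v : ι → ℤ}
    (h : Function.Injective fun i => (u i, v i)) :
    Summable fun i => |((u i : ℝ))⁻¹| ^ 2 * |((v i : ℝ))⁻¹| ^ 2 := by
  have h2 := summable_int_inv_pow le_rfl
  have := h2.mul_of_nonneg h2 (fun _ => abs_nonneg _) (fun _ => abs_nonneg _)
  simpa [Function.comp_def, abs_pow] using this.comp_injective h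

/-- Any two of u, v, w determine the index, so each of the three bounding terms is part of a
convergent double series ∑ 1/(a²b²). -/
theorem summable_of_three_factors {ι : Type*} {u v w : ι → ℤ}
    (huv : Function.Injective fun i => (u i, v i)) (hvw : Function.Injective fun i => (v i, w i))
    (hwu : Function.Injective fun i => (w i, u i)) {r p q : ℕ} (h1 : 2 ≤ r + p)
    (h2 : 2 ≤ p + q) (h3 : 2 ≤ q + r) (h4 : 4 ≤ r + p + q) {f : ι → ℝ} (C : ℝ) (hC : 0 ≤ C)
    (hf : ∀ i, |f i| ≤
      C * (|((u i : ℝ))⁻¹| ^ r * |((v i : ℝ))⁻¹| ^ p * |((w i : ℝ))⁻¹| ^ q)) :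
    Summable f := by
  refine Summable.of_norm_bounded ((((summable_inv_sq_mul_inv_sq huv).add
    (summable_inv_sq_mul_inv_sq hvw)).add (summable_inv_sq_mul_inv_sq hwu)).mul_left C)
    fun i => (hf i).trans ?_
  gcongr
  exact pow_mul_pow_mul_pow_le (abs_nonneg _) (abs_nonneg _) (abs_nonneg _)
    (abs_int_inv_le_one _) (abs_int_inv_le_one _) (abs_int_inv_le_one _) h1 h2 h3 h4

theorem abs_signHarm_add_sub_le {ε : ℝ} (hε : IsSign ε) {r : ℕ} (hr : 2 ≤ r) (k N : ℕ) :
    |signHarm ε r (k + N) - signHarm ε r k| ≤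
      2 * ((k + 1 : ℕ) : ℝ)⁻¹ - 2 * ((k + N + 1 : ℕ) : ℝ)⁻¹ := by
  induction N with
  | zero => simp
  | succ N ih =>
    have h : signHarm ε r (k + (N + 1)) =
        signHarm ε r (k + N) + ε ^ (k + N + 1) * (((k + N + 1 : ℕ) : ℝ)⁻¹) ^ r :=
      Finset.sum_range_succ _ _
    rw [h, add_sub_right_comm]
    refine (abs_add_le _ _).trans ?_
    have hm : (1 : ℝ) ≤ ((k + N + 1 : ℕ) : ℝ) := by exact_mod_cast Nat.le_add_left 1 (k + N)
    have hc : ((k + (N + 1) + 1 : ℕ) : ℝ) = ((k + N + 1 : ℕ) : ℝ) + 1 := by push_cast; ring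
    rw [hc]
    generalize ((k + N + 1 : ℕ) : ℝ) = m at *
    have h1 : |ε ^ (k + N + 1) * m⁻¹ ^ r| ≤ m⁻¹ ^ 2 := by
      rw [abs_mul, hε.abs_pow, one_mul, abs_of_nonneg (by positivity)]
      exact pow_le_pow_of_le_one (by positivity) (inv_le_one_of_one_le₀ hm) hr
    -- The factor 2 makes this telescoping bound hold from m = 1 on.
    have h2 : m⁻¹ ^ 2 ≤ 2 * m⁻¹ - 2 * (m + 1)⁻¹ := by
      have : 2 * m⁻¹ - 2 * (m + 1)⁻¹ - m⁻¹ ^ 2 = (m - 1) / (m ^ 2 * (m + 1)) := by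
        field_simp; ring
      have h3 : 0 ≤ (m - 1) / (m ^ 2 * (m + 1)) :=
        div_nonneg (by linarith) (by positivity)
      linarith
    linarith

theorem abs_signZeta_sub_signHarm_le {ε : ℝ} (hε : IsSign ε) {r : ℕ} (hr : 2 ≤ r) (k : ℕ) :
    |signZeta ε r - signHarm ε r k| ≤ 2 * |(((k + 1 : ℕ) : ℤ) : ℝ)⁻¹| := by
  have h := (tendsto_add_atTop_iff_nat k).2 (tendsto_signHarm hε hr)
  refine le_of_tendsto (h.sub_const _).abs (Eventually.of_forall fun N => ?_)
  rw [add_comm N k]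
  refine (abs_signHarm_add_sub_le hε hr k N).trans ?_
  rw [Int.cast_natCast, abs_of_nonneg (by positivity)]
  have : (0 : ℝ) ≤ 2 * ((k + N + 1 : ℕ) : ℝ)⁻¹ := by positivity
  linarith

/-! ### The kernel `∑_n (-1)^n / (n (n - k)^p)` -/

/-- `∑ (-1)^n / (n (n - k)^p)` over the integers `n ≠ 0, k`. -/
def altKernel (p k : ℕ) : ℝ :=
  ∑' n : ℤ, (-1 : ℝ) ^ n * (n : ℝ)⁻¹ * (((n : ℝ) - k)⁻¹) ^ p

theorem abs_neg_one_zpow (n : ℤ) : |(-1 : ℝ) ^ n| = 1 := by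
  rcases Int.even_or_odd n with h | h
  · simp [h.neg_one_zpow]
  · simp [h.neg_one_zpow]

theorem hasSum_altKernel {p : ℕ} (hp : 1 ≤ p) (k : ℕ) :
    HasSum (fun n : ℤ => (-1 : ℝ) ^ n * (n : ℝ)⁻¹ * (((n : ℝ) - k)⁻¹) ^ p) (altKernel p k) := by
  refine Summable.hasSum ?_
  have h2 := summable_int_inv_pow le_rfl
  have h3 := h2.comp_injective (sub_left_injective (b := (k : ℤ)))
  refine Summable.of_norm_bounded (h2.add h3) fun n => ?_
  rw [norm_mul, norm_mul, Real.norm_eq_abs, abs_neg_one_zpow, one_mul]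
  have h4 := abs_int_inv_le_one (n - k)
  simp only [Function.comp_apply, abs_pow, norm_pow, Real.norm_eq_abs]
  push_cast at h4 ⊢
  have h5 : |((n : ℝ) - k)⁻¹| ^ p ≤ |((n : ℝ) - k)⁻¹| := pow_le_of_le_one (abs_nonneg _) h4
    (by omega)
  nlinarith [abs_nonneg (n : ℝ)⁻¹, sq_nonneg (|(n : ℝ)⁻¹| - |((n : ℝ) - k)⁻¹|),
    sq_nonneg (|(n : ℝ)⁻¹| + |((n : ℝ) - k)⁻¹|),
    mul_le_mul_of_nonneg_left h5 (abs_nonneg (n : ℝ)⁻¹)]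

theorem hasSum_alt_int_inv_pow {i : ℕ} (hi : 2 ≤ i) :
    HasSum (fun n : ℤ => (-1 : ℝ) ^ n * ((n : ℝ)⁻¹) ^ i)
      ((1 + (-1) ^ i) * signZeta (-1) i) := by
  have h := (summable_sign_inv_pow isSign_neg_one hi).hasSum
  have h' : HasSum (fun n : ℕ => (-1 : ℝ) ^ (-(n : ℤ)) * (((-(n : ℤ) : ℤ) : ℝ)⁻¹) ^ i)
      ((-1) ^ i * signZeta (-1) i) := by
    refine (h.mul_left ((-1) ^ i)).congr_fun fun n => ?_
    rw [zpow_neg, zpow_natCast, ← inv_pow, inv_neg_one]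
    push_cast
    rw [inv_neg, neg_pow ((n : ℝ)⁻¹)]
    ring
  have h0 : HasSum (fun n : ℕ => (-1 : ℝ) ^ (n : ℤ) * (((n : ℤ) : ℝ)⁻¹) ^ i)
      (signZeta (-1) i) := by simpa [signZeta] using h
  have := HasSum.of_nat_of_neg (f := fun n : ℤ => (-1 : ℝ) ^ n * ((n : ℝ)⁻¹) ^ i) h0 h'
  simpa [show i ≠ 0 by omega, add_mul] using this

theorem hasSum_alt_shift {i : ℕ} (hi : 2 ≤ i) (k : ℕ) :
    HasSum (fun n : ℤ => (-1 : ℝ) ^ n * (((n : ℝ) - k)⁻¹) ^ i)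
      ((-1) ^ k * ((1 + (-1) ^ i) * signZeta (-1) i)) := by
  rw [← (Equiv.addRight (k : ℤ)).hasSum_iff]
  refine ((hasSum_alt_int_inv_pow hi).mul_left ((-1) ^ k)).congr_fun fun n => ?_
  simp [zpow_add₀]
  ring

theorem altKernel_zero {p : ℕ} (hp : 1 ≤ p) :
    altKernel p 0 = (1 + (-1) ^ (p + 1)) * signZeta (-1) (p + 1) := by
  rw [← (hasSum_alt_int_inv_pow (i := p + 1) (by omega)).tsum_eq, altKernel]
  refine tsum_congr fun n => ?_
  rw [Nat.cast_zero, sub_zero]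
  ring

/-- Apply 1/(n(n - k)) = (1/k)(1/(n - k) - 1/n) once; the subtracted power of 1/k removes n = 0 from
the shifted series. -/
theorem altKernel_succ {p k : ℕ} (hp : 1 ≤ p) (hk : 1 ≤ k) :
    altKernel (p + 1) k = (k : ℝ)⁻¹ * ((-1) ^ k * ((1 + (-1) ^ (p + 1)) * signZeta (-1) (p + 1))
      - (-1) ^ (p + 1) * (k : ℝ)⁻¹ ^ (p + 1) - altKernel p k) := by
  have h0 := hasSum_ite_eq (0 : ℤ) ((-1) ^ (p + 1) * (k : ℝ)⁻¹ ^ (p + 1))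
  refine (hasSum_altKernel (by omega) k).unique ?_
  refine ((((hasSum_alt_shift (i := p + 1) (by omega) k).sub h0).sub
    (hasSum_altKernel hp k)).mul_left _).congr_fun fun n => ?_
  have hk' : (k : ℝ) ≠ 0 := by positivity
  rcases eq_or_ne n 0 with rfl | hn
  · simp [inv_neg, neg_pow ((k : ℝ)⁻¹)]
  rcases eq_or_ne n k with rfl | hnk
  · simp [show p ≠ 0 by omega, show k ≠ 0 by omega]
  have hn' : (n : ℝ) ≠ 0 := by exact_mod_cast hn
  have hnk' : (n : ℝ) - k ≠ 0 := sub_ne_zero.2 (by exact_mod_cast hnk)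
  rw [if_neg hn, sub_zero, pow_succ]
  field_simp
  ring

theorem hasSum_alt_inv_sub_inv_aux {k : ℕ} (hk : 1 ≤ k) :
    HasSum (fun n : ℤ => (-1 : ℝ) ^ n * (((n : ℝ) - k)⁻¹ - (n : ℝ)⁻¹))
      (k * altKernel 1 k - (k : ℝ)⁻¹ - (-1) ^ k * (k : ℝ)⁻¹) := by
  have h0 := hasSum_ite_eq (0 : ℤ) ((k : ℝ)⁻¹)
  have h1 := hasSum_ite_eq (k : ℤ) ((-1) ^ k * (k : ℝ)⁻¹)
  refine ((((hasSum_altKernel le_rfl k).mul_left (k : ℝ)).sub h0).sub h1).congr_fun fun n => ?_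
  have hk' : (k : ℝ) ≠ 0 := by positivity
  rcases eq_or_ne n 0 with rfl | hn
  · simp [inv_neg, show (0 : ℤ) ≠ k by omega]
  rcases eq_or_ne n k with rfl | hnk
  · simp [show k ≠ 0 by omega]
  have hn' : (n : ℝ) ≠ 0 := by exact_mod_cast hn
  have hnk' : (n : ℝ) - k ≠ 0 := sub_ne_zero.2 (by exact_mod_cast hnk)
  rw [if_neg hn, if_neg hnk]
  field_simp
  ring

/-- For k = 1 the reflection n ↦ 1 - n negates the summand. Translates of that case telescope to
general k. -/
theorem hasSum_alt_inv_sub_inv (k : ℕ) :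
    HasSum (fun n : ℤ => (-1 : ℝ) ^ n * (((n : ℝ) - k)⁻¹ - (n : ℝ)⁻¹)) 0 := by
  have h1 : HasSum (fun n : ℤ => (-1 : ℝ) ^ n * (((n : ℝ) - (1 : ℕ))⁻¹ - (n : ℝ)⁻¹)) 0 := by
    have h := hasSum_alt_inv_sub_inv_aux le_rfl
    have h' := (Equiv.subLeft (1 : ℤ)).hasSum_iff.2 h
    have h'' := h.unique (h'.neg.congr_fun fun n => by
      simp only [Function.comp_apply, Equiv.subLeft_apply]
      rw [zpow_sub₀ (by norm_num), zpow_one]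
      push_cast
      rw [show (1 : ℝ) - n - 1 = -n by ring, show (1 : ℝ) - n = -(n - 1) by ring, inv_neg,
        inv_neg]
      rcases Int.even_or_odd n with hn | hn <;> rw [hn.neg_one_zpow] <;> ring)
    have h3 : (1 : ℕ) * altKernel 1 1 - ((1 : ℕ) : ℝ)⁻¹ - (-1) ^ 1 * ((1 : ℕ) : ℝ)⁻¹ = 0 := by
      linarith
    rwa [h3] at h
  induction k with
  | zero => simp
  | succ k ih =>
    have h2 := ((Equiv.subRight (k : ℤ)).hasSum_iff.2 h1).mul_left ((-1) ^ k)
    have h3 := ih.add h2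
    rw [mul_zero, add_zero] at h3
    refine h3.congr_fun fun n => ?_
    simp only [Function.comp_apply, Equiv.subRight_apply]
    rw [zpow_sub₀ (by norm_num), zpow_natCast]
    push_cast
    rw [show (n : ℝ) - k - 1 = n - (k + 1) by ring]
    rcases neg_one_pow_eq_or ℝ k with hk | hk <;> rw [hk] <;> ring

theorem altKernel_one {k : ℕ} (hk : 1 ≤ k) :
    altKernel 1 k = (k : ℝ)⁻¹ ^ 2 + (-1) ^ k * (k : ℝ)⁻¹ ^ 2 := by
  have h := (hasSum_alt_inv_sub_inv_aux hk).unique (hasSum_alt_inv_sub_inv k)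
  have hk' : (k : ℝ) ≠ 0 := by positivity
  field_simp at h ⊢
  linear_combination h

/-- The exponent s absorbs the factor 1/k that each use of `altKernel_succ` produces. -/
theorem redSeries_altKernel {ε : ℝ} (hε : IsSign ε) {r p : ℕ} (hr : 2 ≤ r) (hp : 1 ≤ p)
    (s : ℕ) : RedSeries (r + s + p + 1) fun k =>
      (signZeta ε r - signHarm ε r k) * ((k : ℝ)⁻¹ ^ s * altKernel p k) := by
  have h1 {b : ℕ} (hb : 2 ≤ b) :=
    redSeries_signZeta_sub hε isSign_one hr (show 1 ≤ b by omega) (.inl hb)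
  have h2 {b : ℕ} (hb : 1 ≤ b) := redSeries_signZeta_sub hε isSign_neg_one hr hb (.inr rfl)
  induction p, hp using Nat.le_induction generalizing s with
  | base =>
    refine ((h1 (b := s + 2) (by omega)).add (h2 (b := s + 2) (by omega))).congr fun k hk => ?_
    rw [altKernel_one hk, one_pow]
    ring
  | succ p hp ih =>
    have h3 := h1 (b := s + p + 2) (by omega)
    have h4 := ((h2 (b := s + 1) (by omega)).signZeta_mul isSign_neg_one
      (a := p + 1) (by omega)).ratCast_mul (1 + (-1) ^ (p + 1))
    have h5 := ih (s + 1)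
    rw [show r + (s + 1) + p + 1 = r + s + (p + 1) + 1 by ring] at h5
    rw [show r + (s + p + 2) = r + s + (p + 1) + 1 by ring] at h3
    rw [show r + (s + 1) + (p + 1) = r + s + (p + 1) + 1 by ring] at h4
    refine ((h4.sub (h3.ratCast_mul ((-1) ^ (p + 1)))).sub h5).congr fun k hk => ?_
    rw [altKernel_succ hp hk, one_pow]
    push_cast
    ring

/-! ### Exchanging the order of summation -/

/-- `∑_{k ≥ 0, k ≠ n} (∑_{j > k} ε^j / j^r) / (n - k)^p`. -/
def tailShiftSum (ε : ℝ) (r p : ℕ) (n : ℤ) : ℝ :=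
  ∑' k : ℕ, (signZeta ε r - signHarm ε r k) * (((n : ℝ) - k)⁻¹) ^ p

theorem summable_tail {ε : ℝ} (hε : IsSign ε) {r p : ℕ} (hr : 2 ≤ r) (hp : 2 ≤ p) :
    Summable fun x : ℤ × ℕ => (-1 : ℝ) ^ x.1 * (x.1 : ℝ)⁻¹ *
      ((signZeta ε r - signHarm ε r x.2) * (((x.1 : ℝ) - x.2)⁻¹) ^ p) := by
  refine summable_of_three_factors (u := fun x => x.1) (v := fun x => ((x.2 + 1 : ℕ) : ℤ))
    (w := fun x => x.1 - x.2) (r := 1) (p := 1) (q := p) ?_ ?_ ?_ (by omega) (by omega)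
    (by omega) (by omega) 2 (by norm_num) fun x => ?_
  · rintro ⟨a, b⟩ ⟨c, d⟩ h; simp only [Prod.mk.injEq] at h ⊢; omega
  · rintro ⟨a, b⟩ ⟨c, d⟩ h; simp only [Prod.mk.injEq] at h ⊢; omega
  · rintro ⟨a, b⟩ ⟨c, d⟩ h; simp only [Prod.mk.injEq] at h ⊢; omega
  · rw [abs_mul, abs_mul, abs_neg_one_zpow, abs_mul, abs_pow, one_mul]
    have := abs_signZeta_sub_signHarm_le hε hr x.2
    calc |(x.1 : ℝ)⁻¹| * (|signZeta ε r - signHarm ε r x.2| * |((x.1 : ℝ) - x.2)⁻¹| ^ p)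
        ≤ |(x.1 : ℝ)⁻¹| * (2 * |(((x.2 + 1 : ℕ) : ℤ) : ℝ)⁻¹| * |((x.1 : ℝ) - x.2)⁻¹| ^ p) := by
          gcongr
      _ = _ := by push_cast; ring

theorem altGood_tailShiftSum {ε : ℝ} (hε : IsSign ε) {r p : ℕ} (hr : 2 ≤ r) (hp : 2 ≤ p) :
    AltGood (r + p + 1) (tailShiftSum ε r p) := by
  have hs := summable_tail hε hr hp
  obtain ⟨S, hS⟩ := hs
  have hin (n : ℤ) : HasSum (fun k : ℕ => (-1 : ℝ) ^ n * (n : ℝ)⁻¹ *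
      ((signZeta ε r - signHarm ε r k) * (((n : ℝ) - k)⁻¹) ^ p))
      ((-1 : ℝ) ^ n * (n : ℝ)⁻¹ * tailShiftSum ε r p n) := by
    rw [tailShiftSum, ← tsum_mul_left]
    exact (hS.summable.prod_factor n).hasSum
  have hout (k : ℕ) : HasSum (fun n : ℤ => (-1 : ℝ) ^ n * (n : ℝ)⁻¹ *
      ((signZeta ε r - signHarm ε r k) * (((n : ℝ) - k)⁻¹) ^ p))
      ((signZeta ε r - signHarm ε r k) * ((k : ℝ)⁻¹ ^ 0 * altKernel p k)) := by
    rw [pow_zero, one_mul]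
    exact ((hasSum_altKernel (by omega) k).mul_left _).congr_fun fun n => by ring
  have h1 := hS.prod_fiberwise hin
  have h2 := ((Equiv.prodComm ℕ ℤ).hasSum_iff.2 hS).prod_fiberwise hout
  have h3 := h1.nat_add_neg.seriesEq
  obtain ⟨T, hT, hTm⟩ := redSeries_altKernel hε hr (show 1 ≤ p by omega) 0
  have hST := tendsto_nhds_unique hT h2.seriesEq
  -- The term k = 0 is absent from a series starting at 1, so it is evaluated separately and added
  -- back.
  have h0 : (signZeta ε r - signHarm ε r 0) * (((0 : ℕ) : ℝ)⁻¹ ^ 0 * altKernel p 0) =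
      ((1 + (-1) ^ (p + 1) : ℚ) : ℝ) * (signZeta ε r * signZeta (-1) (p + 1)) := by
    rw [altKernel_zero (by omega)]
    simp [signHarm, show r ≠ 0 by omega]
    ring
  rw [h0] at hST
  have hm := ratCast_mul_mem (1 + (-1) ^ (p + 1)) (mul_mem_of_tendsto_signHarm hε
    (by omega) (.inl hr) (tendsto_signHarm hε hr)
    (signZeta_mem isSign_neg_one (a := p + 1) (by omega)))
  rw [show p + 1 + r = r + p + 1 by ring] at hm
  rw [add_zero] at hTm
  refine ⟨S, ?_, ?_⟩
  · rw [show S + (-1 : ℝ) ^ (0 : ℤ) * ((0 : ℤ) : ℝ)⁻¹ * tailShiftSum ε r p 0 -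
      ((-1 : ℝ) ^ ((0 : ℕ) : ℤ) * (((0 : ℕ) : ℤ) : ℝ)⁻¹ * tailShiftSum ε r p ((0 : ℕ) : ℤ) +
        (-1 : ℝ) ^ (-((0 : ℕ) : ℤ)) * ((-((0 : ℕ) : ℤ) : ℤ) : ℝ)⁻¹ *
          tailShiftSum ε r p (-((0 : ℕ) : ℤ))) = S by simp] at h3
    refine h3.congr fun n _ => ?_
    have h5 : (-1 : ℝ) ^ (-(n : ℤ)) = (-1) ^ n := by
      rw [zpow_neg, zpow_natCast, ← inv_pow, inv_neg_one]
    rw [h5]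
    push_cast
    rw [zpow_natCast, inv_neg]
    ring
  · have := add_mem hTm hm
    rwa [hST, sub_add_cancel] at this

/-! ### Off-diagonal double sums -/

/-- The summand `ε^(k+l) / ((l - k)^r (n - k)^p (n - l)^q)`, set to `0` unless `k`, `l`, `n` are
distinct. -/
def offDiagTerm (ε : ℝ) (n : ℤ) (r p q : ℕ) (x : ℕ × ℕ) : ℝ :=
  if x.1 ≠ x.2 ∧ n ≠ x.1 ∧ n ≠ x.2 then
    ε ^ (x.1 + x.2) * ((((x.2 : ℝ) - x.1)⁻¹) ^ r * (((n : ℝ) - x.1)⁻¹) ^ p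
      * (((n : ℝ) - x.2)⁻¹) ^ q)
  else 0

/-- The sum of `offDiagTerm` over all pairs `(k, l)`. -/
def offDiagSum (ε : ℝ) (r p q : ℕ) (n : ℤ) : ℝ := ∑' x : ℕ × ℕ, offDiagTerm ε n r p q x

theorem hasSum_offDiagSum {ε : ℝ} (hε : IsSign ε) {r p q : ℕ} (h1 : 2 ≤ r + p) (h2 : 2 ≤ p + q)
    (h3 : 2 ≤ q + r) (h4 : 4 ≤ r + p + q) (n : ℤ) :
    HasSum (offDiagTerm ε n r p q) (offDiagSum ε r p q n) := by
  refine (summable_of_three_factors (u := fun x : ℕ × ℕ => (x.2 : ℤ) - x.1)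
    (v := fun x => n - x.1) (w := fun x => n - x.2) ?_ ?_ ?_ h1 h2 h3 h4 1 zero_le_one
    fun x => ?_).hasSum
  · rintro ⟨a, b⟩ ⟨c, d⟩ h; simp only [Prod.mk.injEq] at h ⊢; omega
  · rintro ⟨a, b⟩ ⟨c, d⟩ h; simp only [Prod.mk.injEq] at h ⊢; omega
  · rintro ⟨a, b⟩ ⟨c, d⟩ h; simp only [Prod.mk.injEq] at h ⊢; omega
  · rw [offDiagTerm, one_mul]
    split_ifs
    · rw [abs_mul, hε.abs_pow, one_mul, abs_mul, abs_mul, abs_pow, abs_pow, abs_pow]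
      push_cast
      rfl
    · rw [abs_zero]; positivity

theorem offDiagSum_swap (ε : ℝ) (r p q : ℕ) (n : ℤ) :
    offDiagSum ε r p q n = (-1) ^ r * offDiagSum ε r q p n := by
  rw [offDiagSum, offDiagSum, ← (Equiv.prodComm ℕ ℕ).tsum_eq, ← tsum_mul_left]
  refine tsum_congr fun x => ?_
  simp only [offDiagTerm, Equiv.prodComm_apply, Prod.fst_swap, Prod.snd_swap, mul_ite, mul_zero]
  refine if_congr (by tauto) ?_ rfl
  rw [← neg_sub (x.2 : ℝ), inv_neg, neg_pow ((x.2 - x.1 : ℝ)⁻¹), add_comm]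
  ring

theorem offDiagSum_one_one (ε : ℝ) {r : ℕ} (hr : Odd r) (n : ℤ) : offDiagSum ε r 1 1 n = 0 := by
  have := offDiagSum_swap ε r 1 1 n
  rw [hr.neg_one_pow] at this
  linarith

theorem offDiagSum_succ_succ {ε : ℝ} (hε : IsSign ε) {r p q : ℕ} (h1 : 1 ≤ r + p)
    (h2 : 1 ≤ p + q) (h3 : 1 ≤ q + r) (h4 : 2 ≤ r + p + q) (n : ℤ) :
    offDiagSum ε r (p + 1) (q + 1) n =
      offDiagSum ε (r + 1) p (q + 1) n - offDiagSum ε (r + 1) (p + 1) q n := by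
  refine (hasSum_offDiagSum hε (by omega) (by omega) (by omega) (by omega) n).unique ?_
  refine ((hasSum_offDiagSum hε (by omega) (by omega) (by omega) (by omega) n).sub
    (hasSum_offDiagSum hε (by omega) (by omega) (by omega) (by omega) n)).congr_fun fun x => ?_
  simp only [offDiagTerm]
  split_ifs with h
  · obtain ⟨ha, hb, hc⟩ := h
    have ha' : (x.2 : ℝ) - x.1 ≠ 0 := sub_ne_zero.2 (by exact_mod_cast ha.symm)
    have hb' : (n : ℝ) - x.1 ≠ 0 := sub_ne_zero.2 (by exact_mod_cast hb)
    have hc' : (n : ℝ) - x.2 ≠ 0 := sub_ne_zero.2 (by exact_mod_cast hc)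
    have key : ((n : ℝ) - x.1)⁻¹ * ((n : ℝ) - x.2)⁻¹ =
        ((x.2 : ℝ) - x.1)⁻¹ * (((n : ℝ) - x.2)⁻¹ - ((n : ℝ) - x.1)⁻¹) := by
      field_simp
      ring
    simp only [pow_succ]
    linear_combination (ε ^ (x.1 + x.2) * ((((x.2 : ℝ) - x.1)⁻¹) ^ r * (((n : ℝ) - x.1)⁻¹) ^ p
      * (((n : ℝ) - x.2)⁻¹) ^ q)) * key
  · simp

/-- On the diagonal ε^(2k) = 1, so the sign disappears. -/
theorem shiftSum_mul_shiftSum {ε : ℝ} (hε : IsSign ε) {p q : ℕ} (hp : 2 ≤ p) (hq : 2 ≤ q)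
    (n : ℤ) : shiftSum ε p n * shiftSum ε q n = shiftSum 1 (p + q) n + offDiagSum ε 0 p q n := by
  have hp' := (hasSum_shiftSum hε hp n).summable.norm
  have hq' := (hasSum_shiftSum hε hq n).summable.norm
  have hprod := (hasSum_shiftSum hε hp n).mul (hasSum_shiftSum hε hq n)
    (summable_mul_of_summable_norm hp' hq')
  have hdiag : HasSum (fun x : ℕ × ℕ => if x.1 = x.2 then (((n : ℝ) - x.1)⁻¹) ^ (p + q) else 0)
      (shiftSum 1 (p + q) n) := by
    have hinj : Function.Injective fun k : ℕ => (k, k) := fun a b h => (Prod.mk.inj h).1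
    rw [← hinj.hasSum_iff]
    · simpa [Function.comp_def] using hasSum_shiftSum isSign_one (p := p + q) (by omega) n
    · rintro ⟨a, b⟩ hab
      refine if_neg fun h => hab ⟨a, ?_⟩
      simp only at h
      rw [h]
  refine hprod.unique ((hdiag.add (hasSum_offDiagSum hε (by omega) (by omega) (by omega)
    (by omega) n)).congr_fun fun x => ?_)
  rw [offDiagTerm]
  by_cases h : x.1 = x.2
  · rw [if_pos h, if_neg (by tauto), ← h]
    linear_combination (((n : ℝ) - x.1)⁻¹) ^ (p + q) * hε.mul_self_pow x.1
  · rw [if_neg h, zero_add]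
    split_ifs with h'
    · ring
    -- The omitted pairs with k = n or l = n contribute nothing to the product, because 0⁻¹ = 0 and
    -- p, q > 0.
    · rcases (by tauto : n = x.1 ∨ n = x.2) with h'' | h''
      · rw [h'', Int.cast_natCast, sub_self, inv_zero, zero_pow (by omega)]; ring
      · rw [h'', Int.cast_natCast, sub_self, inv_zero, zero_pow (n := q) (by omega)]; ring

/-- The inner sum of `offDiagSum ε r p 0`. -/
theorem hasSum_offDiagTerm_zero {ε : ℝ} (hε : IsSign ε) {r p : ℕ} (hr : 2 ≤ r) (hp : 2 ≤ p)
    (n : ℤ) (k : ℕ) :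
    HasSum (fun l => offDiagTerm ε n r p 0 (k, l))
      ((-1) ^ r * ((1 + (-1) ^ r) * signZeta ε r * (((n : ℝ) - k)⁻¹) ^ p
        - (signZeta ε r - signHarm ε r k) * (((n : ℝ) - k)⁻¹) ^ p)
        - if 0 ≤ n then ε ^ n.toNat * (ε ^ k * (((n : ℝ) - k)⁻¹) ^ (r + p)) else 0) := by
  -- `h1` sums over all l ≠ k; `h2` is the term l = n omitted by `offDiagTerm`, which occurs only
  -- for n ≥ 0.
  have h1 := (hasSum_shiftSum hε hr k).mul_left ((-1) ^ r * ε ^ k * (((n : ℝ) - k)⁻¹) ^ p)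
  have h2 := hasSum_ite_eq n.toNat
    (if 0 ≤ n then ε ^ n.toNat * (ε ^ k * (((n : ℝ) - k)⁻¹) ^ (r + p)) else 0)
  have h3 := h1.sub h2
  rw [shiftSum_natCast hε hr] at h3
  have hv : (-1) ^ r * ((1 + (-1) ^ r) * signZeta ε r * (((n : ℝ) - k)⁻¹) ^ p
        - (signZeta ε r - signHarm ε r k) * (((n : ℝ) - k)⁻¹) ^ p) =
      (-1) ^ r * ε ^ k * (((n : ℝ) - k)⁻¹) ^ p *
        (ε ^ k * (signHarm ε r k + (-1) ^ r * signZeta ε r)) := by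
    linear_combination (-(-1) ^ r * (((n : ℝ) - k)⁻¹) ^ p *
      (signHarm ε r k + (-1) ^ r * signZeta ε r)) * hε.mul_self_pow k
  rw [hv]
  refine h3.congr_fun fun l => ?_
  have hneg : (((k : ℤ) : ℝ) - l)⁻¹ = -((l : ℝ) - k)⁻¹ := by
    rw [Int.cast_natCast, ← neg_sub (l : ℝ), inv_neg]
  have hr1 : (-1 : ℝ) ^ r * (-1) ^ r = 1 := by rw [← mul_pow]; simp
  rw [hneg, neg_pow ((l - k : ℝ)⁻¹), offDiagTerm]
  simp only
  by_cases hl : l = n.toNat ∧ 0 ≤ n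
  · obtain ⟨rfl, hn⟩ := hl
    lift n to ℕ using hn
    simp only [Int.toNat_natCast, Int.natCast_nonneg, if_true, Int.cast_natCast]
    rw [if_neg (by tauto), pow_add]
    linear_combination (-ε ^ n * ε ^ k * (((n : ℝ) - k)⁻¹) ^ r * (((n : ℝ) - k)⁻¹) ^ p) * hr1
  · rw [show (if l = n.toNat then
      (if 0 ≤ n then ε ^ n.toNat * (ε ^ k * (((n : ℝ) - k)⁻¹) ^ (r + p)) else 0) else 0)
      = 0 by split_ifs <;> tauto, sub_zero]
    split_ifs with h
    · rw [pow_add, pow_zero]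
      linear_combination (-ε ^ l * ε ^ k * (((l : ℝ) - k)⁻¹) ^ r * (((n : ℝ) - k)⁻¹) ^ p) * hr1
    · have hnl : n ≠ l := by omega
      rcases (by tauto : k = l ∨ n = k) with rfl | rfl
      · simp [show r ≠ 0 by omega]
      · simp [show p ≠ 0 by omega]

theorem offDiagSum_zero {ε : ℝ} (hε : IsSign ε) {r p : ℕ} (hr : 2 ≤ r) (hp : 2 ≤ p) (n : ℤ) :
    offDiagSum ε r p 0 n =
      (-1) ^ r * ((1 + (-1) ^ r) * (signZeta ε r * shiftSum 1 p n) - tailShiftSum ε r p n)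
        - if 0 ≤ n then
          signHarm ε (r + p) n.toNat + (-1) ^ (r + p) * signZeta ε (r + p) else 0 := by
  have h := (hasSum_offDiagSum hε (r := r) (p := p) (q := 0) (by omega) (by omega) (by omega)
    (by omega) n).prod_fiberwise (hasSum_offDiagTerm_zero hε hr hp n)
  have h1 := hasSum_shiftSum isSign_one hp n
  simp only [one_pow, one_mul] at h1
  have h2 : HasSum (fun k : ℕ => (signZeta ε r - signHarm ε r k) * (((n : ℝ) - k)⁻¹) ^ p)
      (tailShiftSum ε r p n) := by
    refine Summable.hasSum (Summable.of_norm_bounded ((summable_shift hp n).mul_left 2)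
      fun k => ?_)
    rw [norm_mul, Real.norm_eq_abs, Real.norm_eq_abs]
    gcongr
    have := abs_signZeta_sub_signHarm_le hε hr k
    have := abs_int_inv_le_one ((k + 1 : ℕ) : ℤ)
    linarith
  have h3 : HasSum (fun k : ℕ =>
      if 0 ≤ n then ε ^ n.toNat * (ε ^ k * (((n : ℝ) - k)⁻¹) ^ (r + p)) else 0)
      (if 0 ≤ n then
          signHarm ε (r + p) n.toNat + (-1) ^ (r + p) * signZeta ε (r + p) else 0) := by
    split_ifs with hn
    · have h4 := (hasSum_shiftSum hε (p := r + p) (by omega) n).mul_left (ε ^ n.toNat)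
      lift n to ℕ using hn
      rwa [shiftSum_natCast hε (by omega), Int.toNat_natCast, ← mul_assoc, hε.mul_self_pow,
        one_mul] at h4
    · exact hasSum_zero
  rw [h.unique ((((h1.mul_left ((1 + (-1) ^ r) * signZeta ε r)).sub h2).mul_left
    ((-1) ^ r)).sub h3)]
  ring

theorem altGood_offDiagSum_zero {ε : ℝ} (hε : IsSign ε) {r p : ℕ} (hr : 2 ≤ r) (hp : 2 ≤ p) :
    AltGood (r + p + 1) (offDiagSum ε r p 0) := by
  have h1 := (altGood_shiftSum_one hp).signZeta_mul hε hr
  rw [show p + 1 + r = r + p + 1 by ring] at h1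
  have h2 := altGood_tailShiftSum hε hr hp
  have h3 := altGood_ite hε (p := r + p) (by omega)
  have h := (((h1.ratCast_mul (1 + (-1) ^ r)).sub h2).ratCast_mul ((-1) ^ r)).sub h3
  have heq := funext (offDiagSum_zero hε hr hp)
  rw [heq]
  simpa using h

/-- Partial fractions preserve the total exponent, so at two simple poles r is odd and the sum
vanishes. Stopping there means that an exponent 0 only ever appears beside one that is at least 2,
as `altGood_offDiagSum_zero` requires. -/
theorem altGood_offDiagSum {ε : ℝ} (hε : IsSign ε) (r p q : ℕ) (h1 : 1 ≤ r + p)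
    (h2 : 1 ≤ r + q) (h3 : 2 ≤ r + p + q) (hodd : Odd (r + p + q)) :
    AltGood (r + p + q + 3) (offDiagSum ε r (p + 1) (q + 1)) := by
  induction hN : p + q generalizing r p q with
  | zero =>
    obtain ⟨rfl, rfl⟩ : p = 0 ∧ q = 0 := by omega
    exact AltGood.zero.congr fun n _ => by simp [offDiagSum_one_one ε (r := r) (by simpa using hodd)]
  | succ N ih =>
    have hp : AltGood (r + p + q + 3) (offDiagSum ε (r + 1) p (q + 1)) := by
      cases p with
      | zero =>
        have h := (altGood_offDiagSum_zero hε (r := r + 1) (p := q + 1) (by omega)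
          (by omega)).ratCast_mul ((-1) ^ (r + 1))
        rw [show r + 1 + (q + 1) + 1 = r + 0 + q + 3 by ring] at h
        rw [funext (offDiagSum_swap ε (r + 1) 0 (q + 1))]
        simpa using h
      | succ p =>
        have h := ih (r + 1) p q (by omega) (by omega) (by omega)
          (by rwa [show r + 1 + p + q = r + (p + 1) + q by ring]) (by omega)
        rwa [show r + 1 + p + q = r + (p + 1) + q by ring] at h
    have hq : AltGood (r + p + q + 3) (offDiagSum ε (r + 1) (p + 1) q) := by
      cases q with
      | zero =>
        have h := altGood_offDiagSum_zero hε (r := r + 1) (p := p + 1) (by omega) (by omega)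
        rwa [show r + 1 + (p + 1) + 1 = r + p + 0 + 3 by ring] at h
      | succ q =>
        have h := ih (r + 1) p q (by omega) (by omega) (by omega)
          (by rwa [show r + 1 + p + q = r + p + (q + 1) by ring]) (by omega)
        rwa [show r + 1 + p + q = r + p + (q + 1) by ring] at h
    rw [funext (offDiagSum_succ_succ hε h1 (by omega) (by omega) h3)]
    exact hp.sub hq

/-! ### Quadratic sums -/

theorem redSeries_signHarm_mul_signHarm {ε : ℝ} (hε : IsSign ε) {p q : ℕ} (hp : 2 ≤ p)
    (hq : 2 ≤ q) (hpq : Odd (p + q)) :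
    RedSeries (p + q + 1) fun n =>
      (-1) ^ n * (n : ℝ)⁻¹ * (signHarm ε p n * signHarm ε q n) := by
  refine redSeries_of_altGood_mul hε hp hq hpq ?_
  rw [funext (shiftSum_mul_shiftSum hε hp hq)]
  refine (altGood_shiftSum_one (by omega)).add ?_
  obtain ⟨p, rfl⟩ := Nat.exists_eq_add_of_le' (show 1 ≤ p by omega)
  obtain ⟨q, rfl⟩ := Nat.exists_eq_add_of_le' (show 1 ≤ q by omega)
  have h := altGood_offDiagSum hε 0 p q (by omega) (by omega) (by omega)
    (by rw [Nat.odd_iff] at hpq ⊢; omega)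
  rwa [show 0 + p + q + 3 = p + 1 + (q + 1) + 1 by ring] at h

end

end EulerSums

theorem theorem3p4 (p m : ℕ) (hp : 2 ≤ p) :
    (∃ S : ℝ,
      EulerSums.SeriesEq
        (fun n => EulerSums.harm p n * EulerSums.harm (p + 2 * m + 1) n / (n : ℝ)
          * EulerSums.altSign n) S ∧
      S ∈ EulerSums.reducibleToLinear (2 * p + 2 * m + 2)) ∧
    (∃ S : ℝ,
      EulerSums.SeriesEq
        (fun n => EulerSums.altHarm p n * EulerSums.altHarm (p + 2 * m + 1) n / (n : ℝ)
          * EulerSums.altSign n) S ∧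
      S ∈ EulerSums.reducibleToLinear (2 * p + 2 * m + 2)) := by
  have hw : 2 * p + 2 * m + 2 = p + (p + 2 * m + 1) + 1 := by ring
  have hodd : Odd (p + (p + 2 * m + 1)) := ⟨p + m, by ring⟩
  -- The negation comes from `altSign n` = -(-1)^n; the two minus signs of `altHarm_eq` cancel in
  -- the product.
  have key {ε : ℝ} (hε : EulerSums.IsSign ε) :=
    (EulerSums.redSeries_signHarm_mul_signHarm hε hp (by omega) hodd).neg
  rw [hw]
  constructor
  · refine (key EulerSums.isSign_one).congr fun n hn => ?_
    rw [EulerSums.harm_eq (by omega), EulerSums.harm_eq (by omega), EulerSums.altSign_eq hn]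
    ring
  · refine (key EulerSums.isSign_neg_one).congr fun n hn => ?_
    rw [EulerSums.altHarm_eq (by omega), EulerSums.altHarm_eq (by omega),
      EulerSums.altSign_eq hn]
    ring
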